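/- Assume the cardinal arithmetic hypothesis that $2^{|\alpha|}>\aleph_\alpha$ for every ordinal $\alpha\ge\omega$. For a Boolean algebra $B$ and $a\in B$, let $B|a$ denote the Boolean algebra $\{y\in B: y\le a\}$ (a factor of $B$). Call $B$ a $Q=F$ Boolean algebra if every homomorphic image of $B$ is isomorphic to $B|a$ for some $a\in B$. The density of a Boolean algebra $A$ is the least cardinality of a set $D$ of nonzero elements of $A$ such that every nonzero element of $A$ is $\ge$ some $d\in D$. A subset $S\subseteq B$ is independent if $\bigwedge_{s\in F}s\wedge\bigwedge_{t\in G}\neg t\neq 0$ for all disjoint finite $F,G\subseteq S$. Let $B^*$ be a $Q=F$ Boolean algebra. Then: 1. There is $n<\omega$ such that the set of nonzero $x\in B^*$ for which $B^*|x$ has density at most $\aleph_n$ is dense (that is, for every nonzero $y\in B^*$ there is a nonzero $x\le y$ with the density of $B^*|x$ at most $\aleph_n$), and such that, for this same $n$, $B^*$ has no independent subset of cardinality $\aleph_n$. 2. $B^*$ has no factor isomorphic to the power set algebra $\mathcal P(\omega)$; that is, there is no $a\in B^*$ with $B^*|a\cong\mathcal P(\omega)$. -/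

import Mathlib

universe u

/-- A Boolean algebra `B` is *quotient equal factor* (`Q = F`) if every homomorphic image of `B`
is isomorphic to a factor `B | a = {y ∈ B : y ≤ a}` of `B`. A homomorphic image has cardinality at
most that of `B`, so it is enough to let `A` range over the universe of `B`; an order isomorphism
between Boolean algebras is the same as an isomorphism of Boolean algebras. -/
def IsQuotientEqualFactor (B : Type u) [BooleanAlgebra B] : Prop :=
  ∀ (A : Type u) [BooleanAlgebra A] (f : BoundedLatticeHom B A), Function.Surjective f →
    ∃ a : B, Nonempty (A ≃o Set.Iic a)

/-- `D` is a dense set of nonzero elements: every nonzero element lies above a member of `D`. -/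
def IsDenseSubset {A : Type u} [PartialOrder A] [OrderBot A] (D : Set A) : Prop :=
  (∀ d ∈ D, d ≠ ⊥) ∧ ∀ x : A, x ≠ ⊥ → ∃ d ∈ D, d ≤ x

/-- The density of `A`: the least cardinality of a dense set of nonzero elements of `A`. -/
noncomputable def algDensity (A : Type u) [PartialOrder A] [OrderBot A] : Cardinal.{u} :=
  sInf {κ : Cardinal.{u} | ∃ D : Set A, IsDenseSubset D ∧ Cardinal.mk D = κ}

/-- `S` is an independent subset of `B`: for all disjoint finite `F, G ⊆ S`, the meet of the
elements of `F` and of the complements of the elements of `G` is nonzero. -/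
def IsIndependentSubset {B : Type u} [BooleanAlgebra B] (S : Set B) : Prop :=
  ∀ F G : Finset B, (F : Set B) ⊆ S → (G : Set B) ⊆ S → Disjoint F G →
    F.inf id ⊓ G.inf compl ≠ ⊥

/-! For a set T of nonzero elements, an ideal maximal among those missing T makes the image of T
dense in the quotient. By Q = F this quotient is a factor, so densities of factors can be steered:
at most |T|, and at least ν everywhere if fewer than ν members of T can always be evaded modulo such
an ideal (`IsQuotientEqualFactor.exists_le_factorDensity`).

Call x homogeneous of density μ if x and all nonzero elements below it have density μ; such elements
lie below every nonzero element. The device has three uses. An infinite independent set of size λ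
gives a nonzero factor with all densities ≥ λ. Density > κ everywhere below one nonzero element, κ
infinite, gives a homogeneous element of density κ⁺. An infinite set ι of homogeneous densities
gives a nonzero factor with all densities ≥ 2^|ι|, because subsets of ι label factors and ι carries
2^|ι| independent subsets.

If no ℵ_n bounded the homogeneous densities, their supremum would be ℵ_β with β ≥ ω. Every ℵ_{γ+1}
with γ < β would occur, hence also a homogeneous density ≥ 2^|β| > ℵ_β, a contradiction. So all of
them are below some ℵ_n, which excludes independent sets of size ℵ_n; and 𝒫(ω) has one of size 2^ℵ₀
> ℵ_ω. -/

section Quotient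

/-! ### Quotients by ideals, realized as factors -/

open scoped symmDiff

/-- A subset of a Boolean algebra that is an ideal (possibly improper). -/
structure IsBoolIdeal {B : Type u} [BooleanAlgebra B] (J : Set B) : Prop where
  bot_mem : ⊥ ∈ J
  mem_of_le : ∀ {x y : B}, x ≤ y → y ∈ J → x ∈ J
  sup_mem : ∀ {x y : B}, x ∈ J → y ∈ J → x ⊔ y ∈ J

variable {B : Type u} [BooleanAlgebra B]

/-- The ring ideal of the Boolean ring of `B` given by an ideal of the Boolean algebra `B`. -/
def IsBoolIdeal.toIdeal {J : Set B} (hJ : IsBoolIdeal J) : Ideal (AsBoolRing B) where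
  carrier := {x | ofBoolRing x ∈ J}
  add_mem' {x y} hx hy := by
    simp only [Set.mem_ofPred_eq, ofBoolRing_add] at *
    exact hJ.mem_of_le symmDiff_le_sup (hJ.sup_mem hx hy)
  zero_mem' := hJ.bot_mem
  smul_mem' c x hx := by
    simp only [Set.mem_ofPred_eq, smul_eq_mul, ofBoolRing_mul] at *
    exact hJ.mem_of_le inf_le_right hx

/-- Every quotient of a `Q = F` Boolean algebra by an ideal `J` is realized by a map onto a
factor. -/
theorem IsQuotientEqualFactor.exists_map (hB : IsQuotientEqualFactor B) {J : Set B}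
    (hJ : IsBoolIdeal J) :
    ∃ (a : B) (φ : B → B), (∀ x, φ x ≤ a) ∧ (∀ y ≤ a, ∃ x, φ x = y) ∧
      ∀ x y, φ x ≤ φ y ↔ x \ y ∈ J := by
  let _ : BooleanRing (AsBoolRing B ⧸ hJ.toIdeal) :=
    { (inferInstance : CommRing (AsBoolRing B ⧸ hJ.toIdeal)) with
      isIdempotentElem := by
        intro x
        obtain ⟨y, rfl⟩ := Ideal.Quotient.mk_surjective x
        change _ * _ = _
        rw [← map_mul, BooleanRing.mul_self] }
  let π : AsBoolRing B →+* (AsBoolRing B ⧸ hJ.toIdeal) := Ideal.Quotient.mk hJ.toIdeal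
  let g : BoundedLatticeHom B (AsBoolAlg (AsBoolRing B ⧸ hJ.toIdeal)) :=
    { toFun := fun x => toBoolAlg (π (toBoolRing x))
      map_sup' := fun x y => π.asBoolAlg.map_sup'
        ((OrderIso.asBoolAlgAsBoolRing B).symm x) ((OrderIso.asBoolAlgAsBoolRing B).symm y) ▸ by
          rw [← map_sup]; rfl
      map_inf' := fun x y => by
        change toBoolAlg (π (toBoolRing x * toBoolRing y)) = _
        rw [map_mul, toBoolAlg_mul]
      map_top' := by
        change toBoolAlg (π 1) = _
        rw [map_one, toBoolAlg_one]
      map_bot' := by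
        change toBoolAlg (π 0) = _
        rw [map_zero, toBoolAlg_zero] }
  have hg : Function.Surjective g := by
    intro z
    obtain ⟨y, hy⟩ := Ideal.Quotient.mk_surjective (ofBoolAlg z)
    exact ⟨ofBoolRing y, hy⟩
  have hg0 : ∀ x, g x = ⊥ ↔ x ∈ J := by
    intro x
    exact Ideal.Quotient.eq_zero_iff_mem
  obtain ⟨a, ⟨e⟩⟩ := hB _ g hg
  refine ⟨a, fun x => (e (g x) : B), fun x => (e (g x)).2, ?_, ?_⟩
  · intro y hy
    obtain ⟨x, hx⟩ := hg (e.symm ⟨y, hy⟩)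
    exact ⟨x, by simp [hx]⟩
  · intro x y
    rw [Subtype.coe_le_coe, e.le_iff_le, ← hg0, map_sdiff', sdiff_eq_bot_iff]

/-- If `T` does not contain `⊥`, an ideal that is maximal among those disjoint from `T` makes the
image of `T` dense in the quotient. -/
theorem exists_boolIdeal_disjoint (T : Set B) (hT : ⊥ ∉ T) :
    ∃ J : Set B, IsBoolIdeal J ∧ (∀ t ∈ T, t ∉ J) ∧ ∀ y, y ∉ J → ∃ t ∈ T, t \ y ∈ J := by
  have h0 : IsBoolIdeal ({⊥} : Set B) :=
    ⟨rfl, fun {x y} h hy => by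
      rw [Set.mem_singleton_iff] at *
      exact le_bot_iff.1 (hy ▸ h), fun {x y} hx hy => by
      rw [Set.mem_singleton_iff] at *
      rw [hx, hy, bot_sup_eq]⟩
  obtain ⟨J, -, hJ⟩ := zorn_subset_nonempty
    {J : Set B | IsBoolIdeal J ∧ ∀ t ∈ T, t ∉ J} (by
      intro c hc hchain hne
      refine ⟨⋃₀ c, ⟨⟨?_, ?_, ?_⟩, ?_⟩, fun s hs => Set.subset_sUnion_of_mem hs⟩
      · obtain ⟨s, hs⟩ := hne
        exact ⟨s, hs, (hc hs).1.bot_mem⟩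
      · rintro x y hxy ⟨s, hs, hy⟩
        exact ⟨s, hs, (hc hs).1.mem_of_le hxy hy⟩
      · rintro x y ⟨s, hs, hx⟩ ⟨t, ht, hy⟩
        rcases hchain.total hs ht with h | h
        · exact ⟨t, ht, (hc ht).1.sup_mem (h hx) hy⟩
        · exact ⟨s, hs, (hc hs).1.sup_mem hx (h hy)⟩
      · rintro t ht ⟨s, hs, hts⟩
        exact (hc hs).2 t ht hts) {⊥} ⟨h0, by rintro t ht rfl; exact hT ht⟩
  refine ⟨J, hJ.prop.1, hJ.prop.2, fun y hy => ?_⟩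
  by_contra hcon
  push Not at hcon
  have hJ' := hJ.prop.1
  -- This is the ideal generated by J and y. If it missed T, maximality would put y into J.
  have hK : {x : B | x \ y ∈ J} ∈ {J : Set B | IsBoolIdeal J ∧ ∀ t ∈ T, t ∉ J} := by
    refine ⟨⟨?_, ?_, ?_⟩, fun t ht => hcon t ht⟩
    · simpa using hJ'.bot_mem
    · intro x z hxz hz
      exact hJ'.mem_of_le (sdiff_le_sdiff_right hxz) hz
    · intro x z hx hz
      simp only [Set.mem_ofPred_eq, sup_sdiff] at *
      exact hJ'.sup_mem hx hz
  have hle := hJ.le_of_ge hK (fun x hx => hJ'.mem_of_le sdiff_le hx)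
  exact hy (hle (by simpa using hJ'.bot_mem))

end Quotient

/-! ### Density of factors and homogeneous elements -/

section Density

variable {B : Type u} [BooleanAlgebra B]

/-- The density of the factor `B | x`. -/
noncomputable def factorDensity (x : B) : Cardinal.{u} := algDensity (Set.Iic x)

theorem algDensity_congr {A A' : Type u} [PartialOrder A] [OrderBot A] [PartialOrder A']
    [OrderBot A'] (e : A ≃o A') : algDensity A = algDensity A' := by
  have key : ∀ {A A' : Type u} [PartialOrder A] [OrderBot A] [PartialOrder A']
    [OrderBot A'] (e : A ≃o A') (D : Set A), IsDenseSubset D → IsDenseSubset (e '' D) := by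
    intro A A' _ _ _ _ e D hD
    refine ⟨?_, fun x hx => ?_⟩
    · rintro _ ⟨d, hd, rfl⟩ h
      exact hD.1 d hd (by simpa using h)
    · obtain ⟨d, hd, hdx⟩ := hD.2 (e.symm x) (by simpa using hx)
      exact ⟨e d, ⟨d, hd, rfl⟩, by rwa [← e.le_symm_apply]⟩
  unfold algDensity
  congr 1
  ext κ
  constructor
  · rintro ⟨D, hD, rfl⟩
    exact ⟨_, key e D hD, Cardinal.mk_image_eq e.injective⟩
  · rintro ⟨D, hD, rfl⟩
    exact ⟨_, key e.symm D hD, Cardinal.mk_image_eq e.symm.injective⟩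

theorem factorDensity_congr {x y : B} (e : Set.Iic x ≃o Set.Iic y) :
    factorDensity x = factorDensity y := algDensity_congr e

theorem factorDensity_le {x : B} (D : Set B) (h0 : ∀ d ∈ D, d ≠ ⊥) (hx : ∀ d ∈ D, d ≤ x)
    (hD : ∀ y ≤ x, y ≠ ⊥ → ∃ d ∈ D, d ≤ y) : factorDensity x ≤ Cardinal.mk D := by
  have h : IsDenseSubset {d : Set.Iic x | (d : B) ∈ D} := by
    refine ⟨fun d hd h => h0 _ hd (by rw [h]; rfl), fun y hy => ?_⟩
    obtain ⟨d, hd, hdy⟩ := hD y y.2 (fun h => hy (Subtype.ext h))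
    exact ⟨⟨d, hx d hd⟩, hd, hdy⟩
  have hle : factorDensity x ≤ Cardinal.mk {d : Set.Iic x | (d : B) ∈ D} :=
    csInf_le' ⟨_, h, rfl⟩
  refine hle.trans ?_
  exact Cardinal.mk_le_of_injective (f := fun d : {d : Set.Iic x | (d : B) ∈ D} =>
    (⟨(d : Set.Iic x), d.2⟩ : D))
    (fun a b h => Subtype.ext (Subtype.ext (congrArg (fun z : D => (z : B)) h)))

theorem exists_dense_of_factorDensity (x : B) : ∃ D : Set B, (∀ d ∈ D, d ≠ ⊥) ∧ (∀ d ∈ D, d ≤ x) ∧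
    (∀ y ≤ x, y ≠ ⊥ → ∃ d ∈ D, d ≤ y) ∧ Cardinal.mk D = factorDensity x := by
  have hne : {κ : Cardinal.{u} | ∃ D : Set (Set.Iic x), IsDenseSubset D ∧
      Cardinal.mk D = κ}.Nonempty :=
    ⟨_, {d | d ≠ ⊥}, ⟨fun d hd => hd, fun y hy => ⟨y, hy, le_rfl⟩⟩, rfl⟩
  obtain ⟨D, hD, hcard⟩ := csInf_mem hne
  refine ⟨Subtype.val '' D, ?_, ?_, ?_, ?_⟩
  · rintro _ ⟨d, hd, rfl⟩ h
    exact hD.1 d hd (Subtype.ext h)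
  · rintro _ ⟨d, -, rfl⟩
    exact d.2
  · intro y hy hy0
    obtain ⟨d, hd, hdy⟩ := hD.2 ⟨y, hy⟩ (fun h => hy0 (congrArg Subtype.val h))
    exact ⟨d, ⟨d, hd, rfl⟩, hdy⟩
  · rw [Cardinal.mk_image_eq Subtype.val_injective]
    exact hcard

theorem le_factorDensity {x : B} {ν : Cardinal.{u}}
    (h : ∀ D : Set B, (∀ d ∈ D, d ≠ ⊥) → (∀ d ∈ D, d ≤ x) → Cardinal.mk D < ν →
      ∃ y ≤ x, y ≠ ⊥ ∧ ∀ d ∈ D, ¬ d ≤ y) : ν ≤ factorDensity x := by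
  by_contra! hlt
  obtain ⟨D, h0, hx, hD, hcard⟩ := exists_dense_of_factorDensity x
  obtain ⟨y, hy, hy0, hyD⟩ := h D h0 hx (hcard ▸ hlt)
  obtain ⟨d, hd, hdy⟩ := hD y hy hy0
  exact hyD d hd hdy

theorem exists_not_le_of_lt_factorDensity {x : B} (X : Set B)
    (hX : Cardinal.mk X < factorDensity x) :
    ∃ y ≤ x, y ≠ ⊥ ∧ ∀ d ∈ X, d ≠ ⊥ → ¬ d ≤ y := by
  by_contra! h
  refine hX.not_ge ((factorDensity_le {d ∈ X | d ≠ ⊥ ∧ d ≤ x} (fun d hd => hd.2.1)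
    (fun d hd => hd.2.2) fun y hy hy0 => ?_).trans (Cardinal.mk_le_mk_of_subset fun d hd => hd.1))
  obtain ⟨d, hd, hd0, hdy⟩ := h y hy hy0
  exact ⟨d, ⟨hd, hd0, hdy.trans hy⟩, hdy⟩

theorem factorDensity_le_mk (x : B) : factorDensity x ≤ Cardinal.mk B :=
  (factorDensity_le {d | d ≠ ⊥ ∧ d ≤ x} (fun _ h => h.1) (fun _ h => h.2)
    fun y hy hy0 => ⟨y, ⟨hy0, hy⟩, le_rfl⟩).trans (Cardinal.mk_set_le _)

/-- Every nonzero element below the nonzero element `x` has density `μ`. -/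
def HasHomogeneousDensity (x : B) (μ : Cardinal.{u}) : Prop :=
  x ≠ ⊥ ∧ ∀ y ≤ x, y ≠ ⊥ → factorDensity y = μ

theorem HasHomogeneousDensity.mono {x y : B} {μ : Cardinal.{u}} (h : HasHomogeneousDensity x μ)
    (hy : y ≤ x) (hy0 : y ≠ ⊥) : HasHomogeneousDensity y μ :=
  ⟨hy0, fun z hz hz0 => h.2 z (hz.trans hy) hz0⟩

theorem HasHomogeneousDensity.unique {x y : B} {μ μ' : Cardinal.{u}}
    (h : HasHomogeneousDensity x μ) (h' : HasHomogeneousDensity y μ') (hxy : x ⊓ y ≠ ⊥) :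
    μ = μ' := by
  rw [← h.2 _ inf_le_left hxy, ← h'.2 _ inf_le_right hxy]

theorem factorDensity_mono {x y : B} (h : y ≤ x) : factorDensity y ≤ factorDensity x := by
  obtain ⟨D, h0, hx, hD, hcard⟩ := exists_dense_of_factorDensity x
  rw [← hcard]
  refine (factorDensity_le {d ∈ D | d ≤ y} (fun d hd => h0 d hd.1) (fun d hd => hd.2)
    fun z hz hz0 => ?_).trans (Cardinal.mk_le_mk_of_subset fun d hd => hd.1)
  obtain ⟨d, hd, hdz⟩ := hD z (hz.trans h) hz0
  exact ⟨d, ⟨hd, hdz.trans hz⟩, hdz⟩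

/-- Cardinals are well-ordered and density is monotone, so a nonzero element of least density below
x is homogeneous. -/
theorem exists_hasHomogeneousDensity {x : B} (hx : x ≠ ⊥) :
    ∃ y ≤ x, ∃ μ, HasHomogeneousDensity y μ := by
  obtain ⟨y, ⟨hy, hy0⟩, hmin⟩ := (InvImage.wf (factorDensity (B := B))
    (Cardinal.lt_wf)).has_min {y | y ≤ x ∧ y ≠ ⊥} ⟨x, le_rfl, hx⟩
  exact ⟨y, hy, factorDensity y, hy0, fun z hz hz0 =>
    (factorDensity_mono hz).antisymm (not_lt.1 (hmin z ⟨hz.trans hy, hz0⟩))⟩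

/-- An isomorphism of factors restricts to isomorphisms of smaller factors. -/
def restrictFactorIso {x y : B} (e : Set.Iic x ≃o Set.Iic y) (z : Set.Iic x) :
    Set.Iic (z : B) ≃o Set.Iic (e z : B) where
  toFun w := ⟨e ⟨w, w.2.trans z.2⟩, e.monotone w.2⟩
  invFun w := ⟨e.symm ⟨w, w.2.trans (e z).2⟩, by
    have := e.symm.monotone (show (⟨w, w.2.trans (e z).2⟩ : Set.Iic y) ≤ e z from w.2)
    simpa using this⟩
  left_inv w := Subtype.ext (by
    change (e.symm (e ⟨w, w.2.trans z.2⟩) : B) = w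
    rw [e.symm_apply_apply])
  right_inv w := Subtype.ext (by
    change (e (e.symm ⟨w, w.2.trans (e z).2⟩) : B) = w
    rw [e.apply_symm_apply])
  map_rel_iff' {a b} := by
    simp only [Equiv.coe_fn_mk, ← Subtype.coe_le_coe]
    exact e.le_iff_le

theorem HasHomogeneousDensity.congr {x y : B} {μ : Cardinal.{u}}
    (h : HasHomogeneousDensity x μ) (e : Set.Iic x ≃o Set.Iic y) : HasHomogeneousDensity y μ := by
  refine ⟨fun h0 => ?_, fun z hz hz0 => ?_⟩
  · apply h.1
    have : (⟨x, le_rfl⟩ : Set.Iic x) = e.symm ⊥ := by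
      rw [← e.symm_apply_apply ⟨x, le_rfl⟩]
      congr 1
      refine Subtype.ext (le_bot_iff.1 ?_)
      exact (e ⟨x, le_rfl⟩).2.trans h0.le
    rw [map_bot] at this
    exact congrArg Subtype.val this
  · have e' := restrictFactorIso e.symm ⟨z, hz⟩
    rw [factorDensity_congr e']
    refine h.2 _ (e.symm ⟨z, hz⟩).2 fun h0 => hz0 ?_
    have h1 : e.symm ⟨z, hz⟩ = ⊥ := Subtype.ext h0
    have h2 : (⟨z, hz⟩ : Set.Iic y) = ⊥ := by simpa using h1
    exact congrArg Subtype.val h2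

end Density

/-! ### Factors with large density everywhere -/

section DenseImage

variable {B : Type u} [BooleanAlgebra B]

/-- Where J is trivial below z, the quotient map is injective there; it is onto because φ y ≤ φ z
forces φ y = φ (y ⊓ z). -/
theorem nonempty_factorIso_of_map {J : Set B} {a : B} {φ : B → B} (hJ : IsBoolIdeal J)
    (hle : ∀ x, φ x ≤ a) (hsurj : ∀ y ≤ a, ∃ x, φ x = y)
    (hord : ∀ x y, φ x ≤ φ y ↔ x \ y ∈ J) {z : B} (hz : ∀ w ≤ z, w ∈ J → w = ⊥) :
    Nonempty (Set.Iic z ≃o Set.Iic (φ z)) := by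
  have hle' : ∀ x y, x ≤ y → φ x ≤ φ y := fun x y h => by
    rw [hord, sdiff_eq_bot_iff.2 h]
    exact hJ.bot_mem
  let f : Set.Iic z ↪o Set.Iic (φ z) := OrderEmbedding.ofMapLEIff
    (fun w => ⟨φ w, hle' _ _ w.2⟩) (by
      intro v w
      rw [← Subtype.coe_le_coe, ← Subtype.coe_le_coe, hord]
      refine ⟨fun h => sdiff_eq_bot_iff.1 (hz _ (sdiff_le.trans v.2) h), fun h => ?_⟩
      rw [sdiff_eq_bot_iff.2 h]
      exact hJ.bot_mem)
  refine ⟨RelIso.ofSurjective f ?_⟩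
  rintro ⟨w, hw⟩
  obtain ⟨y, rfl⟩ := hsurj w (le_trans hw (hle z))
  have hyz : y \ z ∈ J := (hord y z).1 hw
  refine ⟨⟨y ⊓ z, inf_le_right⟩, Subtype.ext (le_antisymm (hle' _ _ inf_le_left) ?_)⟩
  change φ y ≤ φ (y ⊓ z)
  rw [hord]
  simpa using hyz

/-- Passing to a quotient in which the image of `T` is dense. -/
theorem IsQuotientEqualFactor.exists_le_factorDensity (hB : IsQuotientEqualFactor B) (T : Set B)
    (hT : ⊥ ∉ T) (hne : T.Nonempty) (ν : Cardinal.{u})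
    (H : ∀ J : Set B, IsBoolIdeal J → (∀ t ∈ T, t ∉ J) → ∀ t ∈ T, ∀ D ⊆ T, Cardinal.mk D < ν →
      ∃ z ≤ t, z ∉ J ∧ ∀ d ∈ D, d \ z ∉ J) :
    ∃ a : B, a ≠ ⊥ ∧ (∀ y ≤ a, y ≠ ⊥ → ν ≤ factorDensity y) ∧
      factorDensity a ≤ Cardinal.mk T := by
  obtain ⟨J, hJ, hTJ, hdense⟩ := exists_boolIdeal_disjoint T hT
  obtain ⟨a, φ, hle, hsurj, hord⟩ := hB.exists_map hJ
  have hle' : ∀ x y, x ≤ y → φ x ≤ φ y := fun x y h => by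
    rw [hord, sdiff_eq_bot_iff.2 h]
    exact hJ.bot_mem
  have hbot : ∀ x, φ x = ⊥ ↔ x ∈ J := by
    intro x
    obtain ⟨y, hy⟩ := hsurj ⊥ bot_le
    have h0 : φ ⊥ = ⊥ := le_bot_iff.1 (hy ▸ hle' ⊥ y bot_le)
    rw [← le_bot_iff, ← h0, hord, sdiff_bot]
  have hd : ∀ y ≤ a, y ≠ ⊥ → ∃ t ∈ T, φ t ≤ y := by
    intro y hy hy0
    obtain ⟨x, rfl⟩ := hsurj y hy
    obtain ⟨t, ht, htx⟩ := hdense x (fun h => hy0 ((hbot x).2 h))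
    exact ⟨t, ht, (hord _ _).2 htx⟩
  refine ⟨a, ?_, ?_, ?_⟩
  · rintro rfl
    obtain ⟨t, ht⟩ := hne
    exact hTJ t ht ((hbot t).1 (le_bot_iff.1 (hle t)))
  · intro y hy hy0
    refine le_factorDensity fun E hE0 hEy hE => ?_
    choose! g hgT hgE using fun e (he : e ∈ E) => hd e ((hEy e he).trans hy) (hE0 e he)
    obtain ⟨t, ht, hty⟩ := hd y hy hy0
    -- Each e in E lies above the image of some member of T, so evading those members evades E.
    obtain ⟨z, hzt, hzJ, hz⟩ := H J hJ hTJ t ht (g '' E) (by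
      rintro _ ⟨e, he, rfl⟩
      exact hgT e he) (Cardinal.mk_image_le.trans_lt hE)
    refine ⟨φ z, (hle' _ _ hzt).trans hty, fun h => hzJ ((hbot z).1 h), fun e he hez => ?_⟩
    exact hz _ ⟨e, he, rfl⟩ ((hord _ _).1 ((hgE e he).trans hez))
  · refine (factorDensity_le (φ '' T) ?_ ?_ ?_).trans Cardinal.mk_image_le
    · rintro _ ⟨t, ht, rfl⟩ h
      exact hTJ t ht ((hbot t).1 h)
    · rintro _ ⟨t, -, rfl⟩
      exact hle t
    · intro y hy hy0
      obtain ⟨t, ht, hty⟩ := hd y hy hy0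
      exact ⟨_, ⟨t, ht, rfl⟩, hty⟩

theorem exists_forall_notMem_finset {Λ : Type u} [Infinite Λ] {D : Type u} (F : D → Finset Λ)
    (hD : Cardinal.mk D < Cardinal.mk Λ) : ∃ s, ∀ d, s ∉ F d := by
  by_contra! h
  have huniv : (⋃ d, (F d : Set Λ)) = Set.univ := by
    ext s
    simpa using h s
  rcases finite_or_infinite D with hfin | hinf
  · have := Set.finite_iUnion (fun d => (F d).finite_toSet)
    rw [huniv] at this
    exact Set.infinite_univ this
  · have h1 := Cardinal.mk_iUnion_le (fun d => (F d : Set Λ))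
    rw [huniv, Cardinal.mk_univ] at h1
    have h2 : (⨆ d, Cardinal.mk (F d : Set Λ)) ≤ Cardinal.aleph0 :=
      ciSup_le' fun d => ((F d).finite_toSet.lt_aleph0).le
    have h3 := h1.trans (mul_le_mul_right h2 _)
    rw [Cardinal.mul_aleph0_eq (Cardinal.aleph0_le_mk D)] at h3
    exact hD.not_ge h3

/-- If every element of `T F` splits along every index `s ∉ F`, then some factor has everywhere
density at least the number of indices. -/
theorem IsQuotientEqualFactor.exists_le_factorDensity_of_splitting
    (hB : IsQuotientEqualFactor B) {Λ : Type u} [Infinite Λ] [DecidableEq Λ]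
    (T : Finset Λ → Set B) (P N : Λ → Set B) (h0 : (T ∅).Nonempty) (hbot : ∀ F, ⊥ ∉ T F)
    (hP : ∀ F, ∀ x ∈ T F, ∀ s ∉ F, ∃ y ≤ x, y ∈ T (insert s F) ∧ y ∈ P s)
    (hN : ∀ F, ∀ x ∈ T F, ∀ s ∉ F, ∃ y ≤ x, y ∈ T (insert s F) ∧ y ∈ N s)
    (hPN : ∀ s, ∀ x ∈ P s, ∀ y ∈ N s, x ⊓ y = ⊥) :
    ∃ a : B, a ≠ ⊥ ∧ ∀ y ≤ a, y ≠ ⊥ → Cardinal.mk Λ ≤ factorDensity y := by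
  obtain ⟨a, ha0, ha, -⟩ := hB.exists_le_factorDensity (⋃ F, T F) (by simpa using hbot)
    (h0.mono (Set.subset_iUnion T ∅)) (Cardinal.mk Λ) (by
      intro J hJ hTJ t ht D hDT hD
      obtain ⟨F₀, htF⟩ := Set.mem_iUnion.1 ht
      choose F hF using fun d : D => Set.mem_iUnion.1 (hDT d.2)
      obtain ⟨s, hs⟩ := exists_forall_notMem_finset (fun d => F d ∪ F₀) hD
      -- For empty D the choice of s above says nothing about F₀; infinitude of Λ then supplies s.
      have hs₀ : ∃ s, s ∉ F₀ ∧ ∀ d, s ∉ F d := by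
        rcases isEmpty_or_nonempty D with hemp | ⟨⟨d⟩⟩
        · obtain ⟨s, hs⟩ := Infinite.exists_notMem_finset F₀
          exact ⟨s, hs, fun d => hemp.elim d⟩
        · exact ⟨s, fun h => hs d (Finset.mem_union_right _ h),
            fun d h => hs d (Finset.mem_union_left _ h)⟩
      obtain ⟨s, hs₀, hs⟩ := hs₀
      obtain ⟨z, hzt, hzT, hzP⟩ := hP F₀ t htF s hs₀
      refine ⟨z, hzt, hTJ z (Set.mem_iUnion.2 ⟨_, hzT⟩), fun d hd hdz => ?_⟩
      -- Splitting t and d along the same fresh index, in opposite directions, gives w ≤ d \ z with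
      -- w in T, hence outside J.
      obtain ⟨w, hwd, hwT, hwN⟩ := hN (F ⟨d, hd⟩) d (hF ⟨d, hd⟩) s (hs ⟨d, hd⟩)
      refine hTJ w (Set.mem_iUnion.2 ⟨_, hwT⟩) (hJ.mem_of_le ?_ hdz)
      rw [le_sdiff, disjoint_iff, inf_comm]
      exact ⟨hwd, hPN s z hzP w hwN⟩)
  exact ⟨a, ha0, ha⟩

theorem IsQuotientEqualFactor.exists_le_factorDensity_of_independent
    (hB : IsQuotientEqualFactor B) {S : Set B} (hS : IsIndependentSubset S) [Infinite S] :
    ∃ a : B, a ≠ ⊥ ∧ ∀ y ≤ a, y ≠ ⊥ → Cardinal.mk S ≤ factorDensity y := by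
  classical
  refine hB.exists_le_factorDensity_of_splitting (Λ := S)
    (fun F => {x | ∃ G ⊆ F, x = G.inf (fun s => (s : B)) ⊓ (F \ G).inf (fun s => (s : B)ᶜ)})
    (fun s => {x | x ≤ s}) (fun s => {x | x ≤ (s : B)ᶜ}) ⟨_, ∅, le_rfl, rfl⟩ ?_ ?_ ?_ ?_
  · rintro F ⟨G, hG, h⟩
    refine hS (G.image Subtype.val) ((F \ G).image Subtype.val) ?_ ?_ ?_ ?_
    · intro x hx
      obtain ⟨s, -, rfl⟩ := Finset.mem_image.1 (Finset.mem_coe.1 hx)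
      exact s.2
    · intro x hx
      obtain ⟨s, -, rfl⟩ := Finset.mem_image.1 (Finset.mem_coe.1 hx)
      exact s.2
    · rw [Finset.disjoint_image Subtype.val_injective]
      exact Finset.disjoint_sdiff
    · rw [Finset.inf_image, Finset.inf_image]
      exact h.symm
  · rintro F _ ⟨G, hG, rfl⟩ s hs
    refine ⟨_, ?_, ⟨insert s G, Finset.insert_subset_insert _ hG, rfl⟩, ?_⟩
    · rw [Finset.inf_insert, Finset.insert_sdiff_insert, Finset.sdiff_insert_of_notMem hs]
      exact inf_le_inf_right _ inf_le_right
    · rw [Set.mem_ofPred_eq, Finset.inf_insert]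
      exact inf_le_left.trans inf_le_left
  · rintro F _ ⟨G, hG, rfl⟩ s hs
    have hsG : s ∉ G := fun h => hs (hG h)
    refine ⟨_, ?_, ⟨G, hG.trans (Finset.subset_insert _ _), rfl⟩, ?_⟩
    · rw [Finset.insert_sdiff_of_notMem _ hsG, Finset.inf_insert]
      exact inf_le_inf_left _ inf_le_right
    · rw [Set.mem_ofPred_eq, Finset.insert_sdiff_of_notMem _ hsG, Finset.inf_insert]
      exact inf_le_right.trans inf_le_left
  · intro s x hx y hy
    exact le_bot_iff.1 ((inf_le_inf hx hy).trans (inf_compl_self _).le)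

/-! ### Independent families and factors labelled by sets of densities -/

/-- Hausdorff's theorem: an infinite set `ι` has an independent family of `2 ^ #ι` subsets. -/
theorem exists_independent_family (ι : Type u) [Infinite ι] :
    ∃ s : Set ι → Set ι, ∀ (F : Finset (Set ι)) (G : Set (Set ι)),
      ∃ p, ∀ A ∈ F, (p ∈ s A ↔ A ∈ G) := by
  classical
  have hcard : Cardinal.mk (Finset ι × Finset (Finset ι)) = Cardinal.mk ι := by
    simp [Cardinal.mk_finset_of_infinite, Cardinal.mul_eq_self (Cardinal.aleph0_le_mk ι)]
  obtain ⟨e⟩ := Cardinal.eq.1 hcard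
  -- Points code pairs (finite set, finite family of finite sets); A goes to the pairs whose family
  -- contains the trace of A. A finite set separating the members of F then realizes any pattern.
  refine ⟨fun A => {p | ((e.symm p).1.filter (· ∈ A)) ∈ (e.symm p).2}, fun F G => ?_⟩
  have hsep : ∀ A A' : Set ι, ∃ x, A ≠ A' → ¬ (x ∈ A ↔ x ∈ A') := by
    intro A A'
    by_contra! h
    obtain ⟨x⟩ : Nonempty ι := inferInstance
    exact (h x).1 (Set.ext fun y => (h y).2)
  choose g hg using hsep
  let E : Finset ι := (F ×ˢ F).image fun q => g q.1 q.2
  refine ⟨e (E, (F.filter (· ∈ G)).image fun A => E.filter (· ∈ A)), fun A hA => ?_⟩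
  simp only [Set.mem_ofPred_eq, Equiv.symm_apply_apply, Finset.mem_image, Finset.mem_filter]
  constructor
  · rintro ⟨A', ⟨hA', hG⟩, hEq⟩
    by_contra hAG
    have hne : A' ≠ A := by
      rintro rfl
      exact hAG hG
    refine hg A' A hne ?_
    have hmem : g A' A ∈ E := Finset.mem_image.2 ⟨(A', A), Finset.mk_mem_product hA' hA, rfl⟩
    have := Finset.ext_iff.1 hEq (g A' A)
    simpa [hmem] using this
  · intro h
    exact ⟨A, ⟨hA, h⟩, rfl⟩

/-- Factors labelled by sets of prescribed local densities. -/
theorem IsQuotientEqualFactor.exists_labelling (hB : IsQuotientEqualFactor B) {ι : Type u}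
    (μ : ι → Cardinal.{u}) (hμ : Function.Injective μ)
    (hex : ∀ i, ∃ u : B, HasHomogeneousDensity u (μ i)) :
    ∃ R : Set ι → B → Prop, (∀ q, ∃ x, R q x) ∧
      (∀ q q' x, q' ⊆ q → R q x → ∃ y ≤ x, R q' y) ∧
      (∀ q q' x y, Disjoint q q' → R q x → R q' y → x ⊓ y = ⊥) ∧
      ∀ q, q.Nonempty → ¬ R q ⊥ := by
  -- Dividing by this ideal leaves a quotient in which the elements homogeneous of some density μ i,
  -- i ∈ q, are dense.
  let J : Set ι → Set B := fun q =>
    {y | ∀ i ∈ q, ∀ u, HasHomogeneousDensity u (μ i) → y ⊓ u = ⊥}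
  have hJ : ∀ q, IsBoolIdeal (J q) := fun q =>
    ⟨fun i _ u _ => bot_inf_eq u,
      fun h hy i hi u hu => le_bot_iff.1 ((inf_le_inf_right u h).trans (hy i hi u hu).le),
      fun hx hy i hi u hu => by rw [inf_sup_right, hx i hi u hu, hy i hi u hu, bot_sup_eq]⟩
  have hJu : ∀ q, ∀ i ∈ q, ∀ u, HasHomogeneousDensity u (μ i) → ∀ w ≤ u, w ∈ J q → w = ⊥ :=
    fun q i hi u hu w hw hwJ => by rw [← inf_eq_left.2 hw]; exact hwJ i hi u hu
  choose a φ hle hsurj hord using fun q => hB.exists_map (hJ q)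
  have hbelow : ∀ q, ∀ z ≤ a q, z ≠ ⊥ → ∃ u ≤ z, ∃ i ∈ q, HasHomogeneousDensity u (μ i) := by
    intro q z hz hz0
    obtain ⟨x, rfl⟩ := hsurj q z hz
    have hx : x ∉ J q := by
      intro hx
      obtain ⟨y, hy⟩ := hsurj q ⊥ bot_le
      refine hz0 (le_bot_iff.1 ?_)
      rw [← hy, hord]
      exact (hJ q).mem_of_le sdiff_le hx
    change ¬ ∀ i ∈ q, ∀ u, HasHomogeneousDensity u (μ i) → x ⊓ u = ⊥ at hx
    push Not at hx
    obtain ⟨i, hi, u, hu, hxu⟩ := hx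
    have hw := hu.mono inf_le_right hxu
    obtain ⟨e⟩ := nonempty_factorIso_of_map (hJ q) (hle q) (hsurj q) (hord q)
      (hJu q i hi _ hw)
    refine ⟨φ q (x ⊓ u), ?_, i, hi, hw.congr e⟩
    rw [hord, sdiff_eq_bot_iff.2 inf_le_left]
    exact (hJ q).bot_mem
  have hbelow' : ∀ (q : Set ι) (x : B), Nonempty (Set.Iic x ≃o Set.Iic (a q)) → ∀ z ≤ x, z ≠ ⊥ →
      ∃ u ≤ z, ∃ i ∈ q, HasHomogeneousDensity u (μ i) := by
    rintro q x ⟨e⟩ z hz hz0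
    have h0 : (e ⟨z, hz⟩ : B) ≠ ⊥ := by
      intro h
      have h1 : e ⟨z, hz⟩ = ⊥ := Subtype.ext h
      have h2 : (⟨z, hz⟩ : Set.Iic x) = ⊥ := by simpa using h1
      exact hz0 (congrArg Subtype.val h2)
    obtain ⟨u, hu, i, hi, hui⟩ := hbelow q _ (e ⟨z, hz⟩).2 h0
    have e' := restrictFactorIso e.symm ⟨u, hu.trans (e ⟨z, hz⟩).2⟩
    refine ⟨_, ?_, i, hi, hui.congr e'⟩
    have : e.symm ⟨u, hu.trans (e ⟨z, hz⟩).2⟩ ≤ ⟨z, hz⟩ := by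
      rw [e.symm_apply_le]
      exact hu
    exact this
  refine ⟨fun q x => Nonempty (Set.Iic x ≃o Set.Iic (a q)),
    fun q => ⟨a q, ⟨OrderIso.refl _⟩⟩, ?_, ?_, ?_⟩
  -- Below a q' homogeneous pieces with labels in q' ⊆ q are dense, so J q is trivial there and a q'
  -- embeds as a factor below a q.
  · rintro q q' x hq ⟨e⟩
    obtain ⟨f⟩ := nonempty_factorIso_of_map (hJ q) (hle q) (hsurj q) (hord q) (z := a q') (by
      intro w hw hwJ
      by_contra hw0
      obtain ⟨u, hu, i, hi, hui⟩ := hbelow q' w hw hw0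
      exact hui.1 (hJu q i (hq hi) u hui u le_rfl ((hJ q).mem_of_le hu hwJ)))
    exact ⟨_, (e.symm ⟨φ q (a q'), hle q _⟩).2,
      ⟨(restrictFactorIso e.symm ⟨φ q (a q'), hle q _⟩).symm.trans f.symm⟩⟩
  · intro q q' x y hqq' hx hy
    by_contra h0
    obtain ⟨u, hu, i, hi, hui⟩ := hbelow' q x hx _ inf_le_left h0
    obtain ⟨v, hv, j, hj, hvj⟩ := hbelow' q' y hy u (hu.trans inf_le_right) hui.1
    have hij : μ i = μ j := hui.unique hvj (by rw [inf_eq_right.2 hv]; exact hvj.1)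
    exact Set.disjoint_left.1 hqq' hi (hμ hij ▸ hj)
  · rintro q ⟨i, hi⟩ ⟨e⟩
    obtain ⟨u, hu⟩ := hex i
    have ha : ∀ w : Set.Iic (a q), w = ⊥ := fun w => by
      rw [← e.apply_symm_apply w]
      have : e.symm w = ⊥ := Subtype.ext (le_bot_iff.1 (e.symm w).2)
      rw [this, map_bot]
    have h1 : φ q u ≤ φ q ⊥ := by
      have := congrArg Subtype.val (ha ⟨φ q u, hle q u⟩)
      exact (le_of_eq this).trans bot_le
    rw [hord, sdiff_bot] at h1
    exact hu.1 (hJu q i hi u hu u le_rfl h1)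

theorem IsQuotientEqualFactor.exists_two_power_le_factorDensity (hB : IsQuotientEqualFactor B)
    {ι : Type u} [Infinite ι] (μ : ι → Cardinal.{u}) (hμ : Function.Injective μ)
    (hex : ∀ i, ∃ u : B, HasHomogeneousDensity u (μ i)) :
    ∃ a : B, a ≠ ⊥ ∧ ∀ y ≤ a, y ≠ ⊥ → 2 ^ Cardinal.mk ι ≤ factorDensity y := by
  classical
  obtain ⟨R, hR, hsub, hdisj, hbot⟩ := hB.exists_labelling μ hμ hex
  obtain ⟨s, hs⟩ := exists_independent_family ι
  rw [← Cardinal.mk_set]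
  refine hB.exists_le_factorDensity_of_splitting (Λ := Set ι)
    -- G prescribes the side of each s A, A ∈ F. Independence makes this label set nonempty, so its
    -- factors are nonzero.
    (fun F => {x | ∃ G : Set (Set ι), R {p | ∀ A ∈ F, (p ∈ s A ↔ A ∈ G)} x})
    (fun A => {x | ∃ q ⊆ s A, R q x}) (fun A => {x | ∃ q ⊆ (s A)ᶜ, R q x}) ?_ ?_ ?_ ?_ ?_
  · obtain ⟨x, hx⟩ := hR {p | ∀ A ∈ (∅ : Finset (Set ι)), (p ∈ s A ↔ A ∈ (∅ : Set (Set ι)))}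
    exact ⟨x, ∅, hx⟩
  · rintro F ⟨G, hG⟩
    exact hbot _ (hs F G) hG
  · rintro F x ⟨G, hG⟩ A hA
    obtain ⟨y, hyx, hy⟩ := hsub _ {p | ∀ A' ∈ insert A F, (p ∈ s A' ↔ A' ∈ insert A G)} x (by
      intro p hp A' hA'
      have hne : A' ≠ A := by
        rintro rfl
        exact hA hA'
      simpa [hne] using hp A' (Finset.mem_insert_of_mem hA')) hG
    exact ⟨y, hyx, ⟨_, hy⟩, _, fun p hp => (hp A (Finset.mem_insert_self _ _)).2
      (Set.mem_insert _ _), hy⟩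
  · rintro F x ⟨G, hG⟩ A hA
    obtain ⟨y, hyx, hy⟩ := hsub _ {p | ∀ A' ∈ insert A F, (p ∈ s A' ↔ A' ∈ G \ {A})} x (by
      intro p hp A' hA'
      have hne : A' ≠ A := by
        rintro rfl
        exact hA hA'
      simpa [hne] using hp A' (Finset.mem_insert_of_mem hA')) hG
    exact ⟨y, hyx, ⟨_, hy⟩, _, fun p hp h => ((hp A (Finset.mem_insert_self _ _)).1 h).2 rfl, hy⟩
  · rintro A x ⟨q, hq, hx⟩ y ⟨q', hq', hy⟩
    exact hdisj q q' x y (Set.disjoint_left.2 fun p hp hp' => hq' hp' (hq hp)) hx hy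

end DenseImage

/-! ### Successor densities and the bound below ℵ_ω -/

section HomogeneousDensity

variable {B : Type u} [BooleanAlgebra B]

theorem exists_forall_lt_of_mk_le {κ : Cardinal.{u}} (hκ : Cardinal.aleph0 ≤ κ)
    (s : Set (Order.succ κ).ord.ToType) (hs : Cardinal.mk s ≤ κ) : ∃ i, ∀ j ∈ s, j < i := by
  by_contra! h
  have h1 : Order.cof (Order.succ κ).ord.ToType ≤ Cardinal.mk s := Order.cof_le fun i => h i
  rw [Ordinal.cof_toType, (Cardinal.isRegular_succ hκ).cof_ord] at h1
  exact (Order.lt_succ κ).not_ge (h1.trans hs)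

/-- If each element of `X ⊆ Iic a` can be refined with respect to any `κ` elements, there is a set
of cardinality at most `succ κ` containing `a` that is closed under such refinements and
under differences. -/
theorem exists_closed_refinement {κ : Cardinal.{u}} (hκ : Cardinal.aleph0 ≤ κ) (a : B)
    (p : Set B → B → B) (hp : ∀ X c, p X c ≤ c) :
    ∃ A : Set B, a ∈ A ∧ (∀ x ∈ A, x ≤ a) ∧ Cardinal.mk A ≤ Order.succ κ ∧
      (∀ x ∈ A, ∀ y ∈ A, x \ y ∈ A) ∧
      ∀ t ∈ A, ∀ D ⊆ A, Cardinal.mk D ≤ κ → ∃ Y, D ⊆ Y ∧ Cardinal.mk Y ≤ κ ∧ p Y t ∈ A := by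
  let I := (Order.succ κ).ord.ToType
  let step : Set B → Set B := fun Y => insert a (Set.image2 (· \ ·) Y Y ∪ p Y '' Y)
  have hwf : WellFounded ((· < ·) : I → I → Prop) := wellFounded_lt
  -- The recursion has length κ⁺ with stages of size at most κ; by regularity, any κ elements of the
  -- union already lie before one stage.
  let A : I → Set B := hwf.fix fun i rec => step (⋃ j : Set.Iio i, rec j j.2)
  have hA : ∀ i, A i = step (⋃ j : Set.Iio i, A j) := fun i => hwf.fix_eq _ i
  have hIio : ∀ i : I, Cardinal.mk (Set.Iio i) ≤ κ := fun i =>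
    Order.lt_succ_iff.1 ((Cardinal.mk_Iio_lt i (by simp [I])).trans_eq (by simp [I]))
  have hle : ∀ i, ∀ x ∈ A i, x ≤ a := by
    intro i
    induction i using hwf.induction with
    | _ i ih =>
      have hY : ∀ x ∈ ⋃ j : Set.Iio i, A j, x ≤ a := by
        intro x hx
        obtain ⟨j, hj⟩ := Set.mem_iUnion.1 hx
        exact ih j j.2 x hj
      rw [hA]
      rintro _ (rfl | ⟨x, hx, y, -, rfl⟩ | ⟨x, hx, rfl⟩)
      · exact le_rfl
      · exact sdiff_le.trans (hY x hx)
      · exact (hp _ x).trans (hY x hx)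
  have hcardY : ∀ i : I, (∀ j < i, Cardinal.mk (A j) ≤ κ) →
      Cardinal.mk (⋃ j : Set.Iio i, A j) ≤ κ := fun i h =>
    (Cardinal.mk_iUnion_le _).trans ((mul_le_mul' (hIio i)
      (ciSup_le' fun j : Set.Iio i => h j j.2)).trans (Cardinal.mul_eq_self hκ).le)
  have hcard : ∀ i, Cardinal.mk (A i) ≤ κ := by
    intro i
    induction i using hwf.induction with
    | _ i ih =>
      have hY := hcardY i ih
      rw [hA]
      refine (Cardinal.mk_insert_le).trans (Cardinal.add_le_of_le hκ
        ((Cardinal.mk_union_le _ _).trans (Cardinal.add_le_of_le hκ ?_ ?_))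
        (Cardinal.one_le_aleph0.trans hκ))
      · rw [← Set.image_uncurry_prod]
        refine Cardinal.mk_image_le.trans ?_
        rw [Cardinal.mk_setProd]
        exact (mul_le_mul' hY hY).trans (Cardinal.mul_eq_self hκ).le
      · exact Cardinal.mk_image_le.trans hY
  have hub := exists_forall_lt_of_mk_le hκ
  refine ⟨⋃ i, A i, ?_, ?_, ?_, ?_, ?_⟩
  · obtain ⟨i, -⟩ := hub ∅ (by simp)
    refine Set.mem_iUnion.2 ⟨i, ?_⟩
    rw [hA]
    exact Set.mem_insert _ _
  · intro x hx
    obtain ⟨i, hi⟩ := Set.mem_iUnion.1 hx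
    exact hle i x hi
  · refine (Cardinal.mk_iUnion_le _).trans ((mul_le_mul' (le_of_eq ?_)
      (ciSup_le' fun i => (hcard i).trans (Order.le_succ κ))).trans
        (Cardinal.mul_eq_self (hκ.trans (Order.le_succ κ))).le)
    rw [Cardinal.mk_toType, Cardinal.card_ord]
  · intro x hx y hy
    obtain ⟨i, hi⟩ := Set.mem_iUnion.1 hx
    obtain ⟨j, hj⟩ := Set.mem_iUnion.1 hy
    obtain ⟨k, hk⟩ := hub {i, j} ((Cardinal.lt_aleph0_of_finite _).le.trans hκ)
    refine Set.mem_iUnion.2 ⟨k, ?_⟩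
    rw [hA]
    exact Or.inr (Or.inl ⟨x, Set.mem_iUnion.2 ⟨⟨i, hk i (by simp)⟩, hi⟩, y,
      Set.mem_iUnion.2 ⟨⟨j, hk j (by simp)⟩, hj⟩, rfl⟩)
  · intro t ht D hD hDκ
    obtain ⟨i, hi⟩ := Set.mem_iUnion.1 ht
    choose f hf using fun d : D => Set.mem_iUnion.1 (hD d.2)
    obtain ⟨k, hk⟩ := hub (insert i (Set.range f)) (Cardinal.mk_insert_le.trans
      (Cardinal.add_le_of_le hκ (Cardinal.mk_range_le.trans hDκ)
        (Cardinal.one_le_aleph0.trans hκ)))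
    refine ⟨⋃ j : Set.Iio k, A j, fun d hd => ?_, hcardY k fun j _ => hcard j, ?_⟩
    · exact Set.mem_iUnion.2 ⟨⟨_, hk _ (Set.mem_insert_of_mem _ ⟨⟨d, hd⟩, rfl⟩)⟩, hf ⟨d, hd⟩⟩
    · refine Set.mem_iUnion.2 ⟨k, ?_⟩
      rw [hA]
      exact Or.inr (Or.inr ⟨t, Set.mem_iUnion.2 ⟨⟨i, hk _ (Set.mem_insert _ _)⟩, hi⟩, rfl⟩)

theorem IsQuotientEqualFactor.exists_hasHomogeneousDensity_succ (hB : IsQuotientEqualFactor B)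
    {κ : Cardinal.{u}} (hκ : Cardinal.aleph0 ≤ κ) {a : B} (ha : a ≠ ⊥)
    (h : ∀ y ≤ a, y ≠ ⊥ → κ < factorDensity y) :
    ∃ x : B, HasHomogeneousDensity x (Order.succ κ) := by
  have hp : ∀ (X : Set B) (c : B), ∃ b ≤ c, c ≤ a → c ≠ ⊥ → Cardinal.mk X ≤ κ →
      b ≠ ⊥ ∧ ∀ d ∈ X, d ≠ ⊥ → ¬ d ≤ b := by
    intro X c
    by_cases hc : c ≤ a ∧ c ≠ ⊥ ∧ Cardinal.mk X ≤ κ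
    · obtain ⟨b, hb, hb'⟩ := exists_not_le_of_lt_factorDensity X
        (hc.2.2.trans_lt (h c hc.1 hc.2.1))
      exact ⟨b, hb, fun _ _ _ => hb'⟩
    · exact ⟨c, le_rfl, fun h1 h2 h3 => (hc ⟨h1, h2, h3⟩).elim⟩
  choose p hpc hp using hp
  obtain ⟨A, haA, hAa, hAκ, hsdiff, href⟩ := exists_closed_refinement hκ a p hpc
  obtain ⟨x, hx0, hx, hxT⟩ := hB.exists_le_factorDensity (A \ {⊥}) (fun h => h.2 rfl)
    -- The element p Y t lies above no nonzero member of Y ⊇ D, so every d \ p Y t is nonzero;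
    -- closure under differences keeps it in A. The size of A gives the matching upper bound κ⁺.
    ⟨a, haA, ha⟩ (Order.succ κ) (by
      intro J hJ hTJ t ht D hDT hD
      obtain ⟨Y, hDY, hY, hz⟩ := href t ht.1 D (fun d hd => (hDT hd).1) (Order.lt_succ_iff.1 hD)
      obtain ⟨hz0, hzD⟩ := hp Y t (hAa t ht.1) ht.2 hY
      refine ⟨p Y t, hpc Y t, hTJ _ ⟨hz, hz0⟩, fun d hd => hTJ _ ⟨hsdiff d (hDT hd).1 _ hz, ?_⟩⟩
      intro hbot
      exact hzD d (hDY hd) (hDT hd).2 (sdiff_eq_bot_iff.1 hbot))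
  refine ⟨x, hx0, fun y hy hy0 => le_antisymm ?_ (hx y hy hy0)⟩
  exact (factorDensity_mono hy).trans (hxT.trans
    ((Cardinal.mk_le_mk_of_subset Set.sdiff_subset).trans hAκ))

theorem IsQuotientEqualFactor.exists_hasHomogeneousDensity_lt_aleph
    (hyp : ∀ α : Ordinal.{u}, Ordinal.omega0 ≤ α →
      Cardinal.aleph α < (2 : Cardinal.{u}) ^ α.card)
    (hB : IsQuotientEqualFactor B) :
    ∃ n : ℕ, ∀ (x : B) (μ : Cardinal.{u}), HasHomogeneousDensity x μ →
      μ < Cardinal.aleph (n : Ordinal.{u}) := by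
  by_contra! hcon
  let Z : Set Cardinal.{u} := {μ | ∃ x : B, HasHomogeneousDensity x μ}
  have hZ : BddAbove Z := ⟨Cardinal.mk B, by
    rintro μ ⟨x, hx⟩
    rw [← hx.2 x le_rfl hx.1]
    exact factorDensity_le_mk x⟩
  have hn : ∀ n : ℕ, Cardinal.aleph (n : Ordinal.{u}) ≤ sSup Z := fun n => by
    obtain ⟨x, μ, hx, hμ⟩ := hcon n
    exact hμ.trans (le_csSup hZ ⟨x, hx⟩)
  obtain ⟨β, hβ⟩ : sSup Z ∈ Set.range Cardinal.aleph := by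
    rw [Cardinal.mem_range_aleph_iff]
    simpa using hn 0
  have hωβ : Ordinal.omega0 ≤ β := by
    rw [Ordinal.omega0_le]
    intro n
    rw [← Cardinal.aleph_le_aleph, hβ]
    exact hn n
  -- Some homogeneous density exceeds ℵ_γ, and passing to a quotient lowers it to exactly ℵ_{γ+1}.
  have hsucc : ∀ γ < β, ∃ x : B, HasHomogeneousDensity x (Order.succ (Cardinal.aleph γ)) := by
    intro γ hγ
    have hlt : Cardinal.aleph γ < sSup Z := by
      rw [← hβ]
      exact Cardinal.aleph_lt_aleph.2 hγ
    obtain ⟨μ, ⟨x, hx⟩, hμ⟩ := exists_lt_of_lt_csSup' hlt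
    refine hB.exists_hasHomogeneousDensity_succ (Cardinal.aleph0_le_aleph γ) hx.1
      fun y hy hy0 => ?_
    rw [hx.2 y hy hy0]
    exact hμ
  have hcard : Cardinal.mk β.ToType = β.card := Cardinal.mk_toType β
  have : Infinite β.ToType := by
    rw [Cardinal.infinite_iff, hcard, ← Ordinal.card_omega0]
    exact Ordinal.card_le_card hωβ
  obtain ⟨a, ha0, ha⟩ := hB.exists_two_power_le_factorDensity
    (fun i : β.ToType => Order.succ (Cardinal.aleph i.toOrd))
    (fun i j hij => Ordinal.ToType.mk.symm.injective (Subtype.ext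
      (Cardinal.aleph.injective (Order.succ_injective hij))))
    (fun i => hsucc _ i.toOrd.2)
  obtain ⟨y, hya, μ, hy⟩ := exists_hasHomogeneousDensity ha0
  have h1 := ha y hya hy.1
  rw [hy.2 y le_rfl hy.1, hcard] at h1
  exact ((hyp β hωβ).trans_le h1).not_ge (hβ ▸ le_csSup hZ ⟨y, hy⟩)

theorem IsIndependentSubset.mono {S T : Set B} (hS : IsIndependentSubset S) (h : T ⊆ S) :
    IsIndependentSubset T :=
  fun F G hF hG hFG => hS F G (hF.trans h) (hG.trans h) hFG

/-- A factor isomorphic to `𝒫(ω)` yields an independent subset of size continuum. -/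
theorem exists_independentSubset_of_orderIso_set_nat {a : B} (e : Set.Iic a ≃o Set ℕ) :
    ∃ S : Set B, IsIndependentSubset S ∧ Cardinal.mk S = 2 ^ Cardinal.aleph0 := by
  classical
  obtain ⟨s, hs⟩ := exists_independent_family ℕ
  have hs' : Function.Injective s := by
    intro A A' h
    by_contra hne
    obtain ⟨p, hp⟩ := hs {A, A'} {A}
    have h1 := hp A (by simp)
    have h2 := hp A' (by simp)
    rw [h] at h1
    exact hne (h2.1 (h1.2 rfl)).symm
  let g : Set ℕ → B := fun A => e.symm (s A)
  have hg : Function.Injective g := fun A A' h =>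
    hs' (e.symm.injective (Subtype.ext h))
  refine ⟨Set.range g, fun F G hF hG hFG => ?_, ?_⟩
  -- The point p realizes the sign pattern, so the element corresponding to {p} lies below the whole
  -- Boolean combination.
  · obtain ⟨p, hp⟩ := hs ((F ∪ G).preimage g hg.injOn) {A | g A ∈ F}
    simp only [Finset.mem_preimage, Finset.mem_union, Set.mem_ofPred_eq] at hp
    have hpb : (e.symm {p} : B) ≠ ⊥ := by
      intro h
      have h1 : e.symm {p} = ⊥ := Subtype.ext h
      rw [map_eq_bot_iff] at h1
      exact Set.singleton_ne_empty p h1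
    refine fun hbot => hpb (le_bot_iff.1 (hbot ▸ le_inf (Finset.le_inf ?_) (Finset.le_inf ?_)))
    · intro x hx
      obtain ⟨A, rfl⟩ := hF hx
      have hA : p ∈ s A := (hp A (Or.inl hx)).2 hx
      exact e.symm.monotone (Set.singleton_subset_iff.2 hA)
    · intro x hx
      obtain ⟨A, rfl⟩ := hG hx
      have hA : p ∉ s A := fun h =>
        Finset.disjoint_left.1 hFG ((hp A (Or.inr hx)).1 h) hx
      rw [le_compl_iff_disjoint_right, disjoint_iff_inf_le]
      have h1 : e.symm {p} ⊓ e.symm (s A) = ⊥ := by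
        rw [← map_inf, map_eq_bot_iff]
        exact Set.singleton_inter_eq_empty.2 hA
      exact le_of_eq (congrArg Subtype.val h1)
  · have := Cardinal.mk_range_eq_of_injective hg
    rw [← Cardinal.lift_inj.{u, 0}]
    simpa using this

end HomogeneousDensity

theorem mainTheorem1
    (hyp : ∀ α : Ordinal.{u}, Ordinal.omega0 ≤ α →
      Cardinal.aleph α < (2 : Cardinal.{u}) ^ α.card)
    (B : Type u) [BooleanAlgebra B] (hB : IsQuotientEqualFactor B) :
    (∃ n : ℕ,
      IsDenseSubset {x : B | x ≠ ⊥ ∧ algDensity (Set.Iic x) ≤ Cardinal.aleph (n : Ordinal.{u})} ∧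
      ¬ ∃ S : Set B, IsIndependentSubset S ∧
        Cardinal.mk S = Cardinal.aleph (n : Ordinal.{u})) ∧
    ¬ ∃ a : B, Nonempty (Set.Iic a ≃o Set ℕ) := by
  obtain ⟨n, hn⟩ := hB.exists_hasHomogeneousDensity_lt_aleph hyp
  have hind : ¬ ∃ S : Set B, IsIndependentSubset S ∧
      Cardinal.mk S = Cardinal.aleph (n : Ordinal.{u}) := by
    rintro ⟨S, hS, hcard⟩
    have : Infinite S := by
      rw [Cardinal.infinite_iff, hcard]
      exact Cardinal.aleph0_le_aleph _
    obtain ⟨a, ha0, ha⟩ := hB.exists_le_factorDensity_of_independent hS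
    obtain ⟨y, hya, μ, hy⟩ := exists_hasHomogeneousDensity ha0
    have h1 := ha y hya hy.1
    rw [hy.2 y le_rfl hy.1, hcard] at h1
    exact (hn y μ hy).not_ge h1
  refine ⟨⟨n, ⟨fun x hx => hx.1, fun x hx => ?_⟩, hind⟩, ?_⟩
  · obtain ⟨y, hyx, μ, hy⟩ := exists_hasHomogeneousDensity hx
    exact ⟨y, ⟨hy.1, (hy.2 y le_rfl hy.1).trans_le (hn y μ hy).le⟩, hyx⟩
  · rintro ⟨a, ⟨e⟩⟩
    obtain ⟨S, hS, hcard⟩ := exists_independentSubset_of_orderIso_set_nat e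
    -- The hypothesis at α = ω gives ℵ_n < ℵ_ω < 2^ℵ₀, so an independent subset of size ℵ_n can be
    -- extracted.
    have hle : Cardinal.aleph (n : Ordinal.{u}) ≤ Cardinal.mk S := by
      rw [hcard, ← Ordinal.card_omega0]
      exact ((Cardinal.aleph_lt_aleph.2 (Ordinal.natCast_lt_omega0 n)).trans
        (hyp _ le_rfl)).le
    obtain ⟨S', hS', hcard'⟩ := Cardinal.le_mk_iff_exists_subset.1 hle
    exact hind ⟨S', hS.mono hS', hcard'⟩
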